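/- Let $H$ be a complex Hilbert space and let $N_1,N_2$ be closed subspaces of $H$ with $N_1\cap N_2=\{0\}$. Let $P_{N_i}$ be the orthogonal projection onto $N_i$, and write $T=P_{N_2}P_{N_1}$, with numerical range $W(T)=\{\langle Tx,x\rangle : x\in H,\ \|x\|=1\}$ and spectrum $\sigma(T)$. For $\lambda\in[0,1]$ let $\mathscr E(\lambda)$ be the closed domain bounded by the (possibly degenerate) ellipse with foci $0$ and $\lambda$ and minor axis of length $\sqrt{\lambda(1-\lambda)}$, i.e. $\mathscr E(\lambda)=\{z\in\mathbb C: |z|+|z-\lambda|\le\sqrt\lambda\}$. Let $\cos(N_1,N_2)$ be the cosine of the Friedrichs angle: with $M=N_1\cap N_2$, it is $\sup\{|\langle x,y\rangle| : x\in N_1\cap M^\perp,\ y\in N_2\cap M^\perp,\ \|x\|=\|y\|=1\}$ (with $\sup\emptyset=0$). A sequence $(T_n)$ of bounded operators converges arbitrarily slowly to $0$ if $T_nx\to0$ for every $x\in H$ and, for every sequence $(\varphi_n)$ of positive reals with $\varphi_n\to0$, there is $x\in H$ with $\|T_nx\|\ge\varphi_n$ for all $n$. Take $\arg$ with values in $(-\pi,\pi]$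 and $\arg 0=0$. The following assertions are equivalent: 1. $(P_{N_2}P_{N_1})^n$ converges arbitrarily slowly to $0$; 2. $\|P_{N_2}P_{N_1}\|=1$; 3. $N_1^\perp+N_2^\perp$ is not closed; 4. $1\in\sigma(P_{N_2}P_{N_1})$; 5. $\cos(N_1,N_2)=1$; 6. $1\in\overline{W(P_{N_2}P_{N_1})}$; 7. there is a sequence $(\lambda_n)$ in $[0,1)$ with $\lim\lambda_n=1$ such that $\mathscr E(\lambda_n)\subset\overline{W(P_{N_2}P_{N_1})}$ for every $n$; 8. there is no real $\theta<\frac{\pi}{6}$ such that $W(P_{N_2}P_{N_1})\subset\{z\in\mathbb C: |\arg(1-z)|\le\theta\}$. -/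

import Mathlib

open Filter Topology

noncomputable section

namespace TwoProjections

variable {H : Type*} [NormedAddCommGroup H] [InnerProductSpace ℂ H]

/-- The product `P_{M₂} P_{M₁}` of the orthogonal projections onto two closed subspaces
(`P_{M₁}` is applied first). -/
def projProd [CompleteSpace H] (M₂ M₁ : ClosedSubmodule ℂ H) : H →L[ℂ] H :=
  M₂.toSubmodule.starProjection * M₁.toSubmodule.starProjection

/-- The numerical range `W(T) = {⟨T x, x⟩ : ‖x‖ = 1}`. Mathlib's `inner ℂ u v` is conjugate-linear
in `u`, so the scalar product `⟨T x, x⟩`, linear in its first entry, is `inner ℂ x (T x)`. -/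
def numericalRange (T : H →L[ℂ] H) : Set ℂ :=
  {z | ∃ x : H, ‖x‖ = 1 ∧ inner ℂ x (T x) = z}

/-- The cosine of the Friedrichs angle between two subspaces with intersection `M`: the supremum of
`|⟨x, y⟩|` over unit vectors `x ∈ M₁ ∩ Mᗮ` and `y ∈ M₂ ∩ Mᗮ` (`0` if there are no such vectors). -/
def friedrichsCos (M₁ M₂ : Submodule ℂ H) : ℝ :=
  sSup {r : ℝ | ∃ x ∈ M₁ ⊓ (M₁ ⊓ M₂)ᗮ, ∃ y ∈ M₂ ⊓ (M₁ ⊓ M₂)ᗮ,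
    ‖x‖ = 1 ∧ ‖y‖ = 1 ∧ r = ‖inner ℂ x y‖}

/-- The sequence of operators `T n` converges to `L` arbitrarily slowly: it converges to `L`
pointwise, and for every sequence `φ` of positive reals with limit `0` there is a vector `x` such
that `‖T n x - L x‖ ≥ φ n` for all `n`. -/
def ConvergesArbitrarilySlowly (T : ℕ → H →L[ℂ] H) (L : H →L[ℂ] H) : Prop :=
  (∀ x : H, Tendsto (fun n => T n x) atTop (𝓝 (L x))) ∧
    ∀ φ : ℕ → ℝ, (∀ n, 0 < φ n) → Tendsto φ atTop (𝓝 0) →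
      ∃ x : H, ∀ n, φ n ≤ ‖T n x - L x‖

/-- The closed domain bounded by the ellipse with foci `f₁`, `f₂` and minor axis of (full)
length `b`; the major axis then has length `√(|f₁ - f₂|² + b²)`. -/
def ellipseDomain (f₁ f₂ : ℂ) (b : ℝ) : Set ℂ :=
  {z | dist z f₁ + dist z f₂ ≤ Real.sqrt (dist f₁ f₂ ^ 2 + b ^ 2)}

/-- The domain bounded by the ellipse with foci `0`, `lam` and minor axis `√(lam (1 - lam))`, for
`lam ∈ [0, 1]`. -/
def ellipse (lam : ℝ) : Set ℂ :=
  ellipseDomain 0 (lam : ℂ) (Real.sqrt (lam * (1 - lam)))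

/-- The set of all `z` with `|arg (1 - z)| ≤ θ`; here `arg` takes values in `(-π, π]`, and
`arg 0 = 0`. -/
def sectorAtOne (θ : ℝ) : Set ℂ :=
  {z | |Complex.arg (1 - z)| ≤ θ}

end TwoProjections

end

namespace TwoProjections

/-! ### Arbitrarily slow convergence of powers -/

section Slow

variable {E : Type*} [NormedAddCommGroup E] [NormedSpace ℂ E]

/-! Write `K`, `L` for the two subspaces and T = P_L P_K; every condition is compared with ‖T‖ = 1.
If ‖T‖ < 1, then 1 - T is invertible, Kᗮ + Lᗮ is the whole space and the powers of T decay
geometrically. If ‖T‖ = 1, then `K` contains unit vectors almost in `L`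
(`exists_norm_sub_starProjection_lt`); they keep 1 - T from being invertible, Kᗮ + Lᗮ from being
closed, and the cosine below 1. Moreover 1 ∈ σ(T) forces ‖T^n‖ ≥ 1 for all n, and a gliding-hump sum
then yields arbitrarily slow orbits, while pointwise convergence is von Neumann's theorem.

For the numerical range, let A = P_K P_L P_K. If ‖T‖ = 1, then 1 is in σ(A), and it is not isolated
there because K ∩ L = 0. Each l ∈ σ(A) ∩ (0, 1) makes T look approximately like a 2 × 2 matrix whose
numerical range is `ellipse l`. The tangents from 1 to that ellipse make the angle arcsin(√l / 2)
with the real axis, which tends to π/6 as l → 1. Conversely, if ‖T‖ < 1, the Gram determinant of x,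
P_K x, P_L x confines W(T) to a sector of half-angle arcsin k with ‖T‖/2 < k < 1/2. -/

theorem exists_norm_le_norm_apply_near (T : E →L[ℂ] E) (hT : 3 / 4 < ‖T‖) (a : ℝ) (ha : 0 < a)
    (s : E) : ∃ s₁ : E, ‖s₁ - s‖ ≤ a ∧ 3 / 4 * a ≤ ‖T s₁‖ := by
  obtain ⟨x, hx⟩ : ∃ x, 3 / 4 * ‖x‖ < ‖T x‖ := by
    by_contra! h
    exact absurd (T.opNorm_le_bound (by norm_num) h) (not_le.2 hT)
  have hx0 : 0 < ‖x‖ := by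
    rcases eq_or_ne x 0 with rfl | h
    · simp at hx
    · exact norm_pos_iff.2 h
  set v : E := ((a / ‖x‖ : ℝ) : ℂ) • x with hv
  have hvn : ‖v‖ = a := by
    rw [hv, norm_smul, Complex.norm_real, Real.norm_of_nonneg (by positivity)]
    field_simp
  have hTv : 3 / 4 * a ≤ ‖T v‖ := by
    rw [hv, map_smul, norm_smul, Complex.norm_real, Real.norm_of_nonneg (by positivity),
      show 3 / 4 * a = a / ‖x‖ * (3 / 4 * ‖x‖) by field_simp]
    gcongr
  -- As 2 T v = T(s + v) - T(s - v), one of s + v and s - v must work.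
  by_cases h : 3 / 4 * a ≤ ‖T (s + v)‖
  · exact ⟨s + v, by simp [hvn], h⟩
  · refine ⟨s - v, by simp [hvn], ?_⟩
    have h2 : ‖T v + T v‖ ≤ ‖T (s + v)‖ + ‖T (s - v)‖ := by
      have : T v + T v = T (s + v) - T (s - v) := by simp only [map_add, map_sub]; abel
      rw [this]
      exact norm_sub_le _ _
    rw [← two_smul ℝ (T v), norm_smul, Real.norm_of_nonneg (by norm_num)] at h2
    linarith

/-- A sequence of contractions whose norms stay close to `1` admits a vector along which it does
not decay faster than a fixed geometric rate. -/
theorem exists_forall_geometric_le_norm_apply [CompleteSpace E] (T : ℕ → E →L[ℂ] E)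
    (hT : ∀ k, ‖T k‖ ≤ 1) (hT' : ∀ k, 3 / 4 < ‖T k‖) :
    ∃ x : E, ∀ k, 5 / 12 * (1 / 4) ^ k ≤ ‖T k x‖ := by
  choose f hf hf' using fun k s =>
    exists_norm_le_norm_apply_near (T k) (hT' k) ((1 / 4) ^ k) (by positivity) s
  let s : ℕ → E := fun n => Nat.rec 0 (fun k t => f k t) n
  have hs : ∀ k, s (k + 1) = f k (s k) := fun k => rfl
  have hd : ∀ k, dist (s k) (s (k + 1)) ≤ 1 * (1 / 4) ^ k := fun k => by
    rw [dist_comm, dist_eq_norm, hs, one_mul]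
    exact hf k (s k)
  obtain ⟨x, hx⟩ := cauchySeq_tendsto_of_complete
    (cauchySeq_of_le_geometric (1 / 4) 1 (by norm_num) hd)
  refine ⟨x, fun k => ?_⟩
  -- The corrections after stage k total at most (1/3)(1/4)^k, leaving 3/4 - 1/3 = 5/12.
  have h1 := dist_le_of_le_geometric_of_tendsto (1 / 4) 1 (by norm_num) hd hx (k + 1)
  have h2 : 3 / 4 * (1 / 4) ^ k ≤ ‖T k (s (k + 1))‖ := hf' k (s k)
  have h3 : ‖T k (s (k + 1))‖ ≤ ‖T k x‖ + dist (s (k + 1)) x := by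
    have h4 : ‖T k (s (k + 1) - x)‖ ≤ dist (s (k + 1)) x := by
      rw [dist_eq_norm]
      exact (T k).le_of_opNorm_le_of_le (hT k) le_rfl |>.trans (by simp)
    have h5 : T k (s (k + 1)) = T k x + T k (s (k + 1) - x) := by simp
    rw [h5]
    exact (norm_add_le _ _).trans (by gcongr)
  rw [pow_succ] at h1
  have h6 : (1 : ℝ) * ((1 / 4) ^ k * (1 / 4)) / (1 - 1 / 4) = 1 / 3 * (1 / 4) ^ k := by ring
  rw [h6] at h1
  linarith

theorem antitone_norm_pow_apply (T : E →L[ℂ] E) (hT : ‖T‖ ≤ 1) (x : E) :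
    Antitone fun n => ‖(T ^ n) x‖ := by
  refine antitone_nat_of_succ_le fun n => ?_
  rw [pow_succ', mul_apply_eq_comp]
  exact (T.le_of_opNorm_le_of_le hT le_rfl).trans (by simp)

/-- If all powers of a contraction have norm at least `1`, then they decay arbitrarily slowly. -/
theorem exists_forall_le_norm_pow_apply [CompleteSpace E] (T : E →L[ℂ] E) (hT : ‖T‖ ≤ 1)
    (hT' : ∀ n, 1 ≤ ‖T ^ n‖) (φ : ℕ → ℝ) (hφ : Tendsto φ atTop (𝓝 0)) :
    ∃ x : E, ∀ n, φ n ≤ ‖(T ^ n) x‖ := by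
  obtain ⟨B, hB⟩ := hφ.bddAbove_range
  have hB' : ∀ n, φ n ≤ max B 1 := fun n => (hB ⟨n, rfl⟩).trans (le_max_left _ _)
  have hM0 : 0 < max B 1 := lt_max_of_lt_right one_pos
  generalize max B 1 = M at hB' hM0
  have hev : ∀ k : ℕ, ∃ N : ℕ, k ≤ N ∧ ∀ n, N ≤ n → φ n ≤ M * (1 / 4) ^ (k + 1) := by
    intro k
    have h1 : ∀ᶠ n in atTop, φ n ≤ M * (1 / 4) ^ (k + 1) :=
      hφ.eventually (ge_mem_nhds (by positivity))
    obtain ⟨N, hN⟩ := eventually_atTop.1 h1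
    exact ⟨max k N, le_max_left _ _, fun n hn => hN n ((le_max_right _ _).trans hn)⟩
  choose N hkN hN using hev
  obtain ⟨x, hx⟩ := exists_forall_geometric_le_norm_apply (fun k => T ^ N k)
    (fun k => by
      rcases Nat.eq_zero_or_pos (N k) with h | h
      · rw [h, pow_zero]
        exact ContinuousLinearMap.norm_id_le
      · exact (norm_pow_le' T h).trans (pow_le_one₀ (norm_nonneg _) hT))
    (fun k => lt_of_lt_of_le (by norm_num) (hT' _))
  refine ⟨((12 / 5 * M : ℝ) : ℂ) • x, fun n => ?_⟩
  classical
  -- For the least such k, φ n ≤ M (1/4)^k because n lies past the previous threshold, while ‖T^n x‖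
  -- ≥ ‖T^(N k) x‖ by monotonicity. The factor 12/5 in the witness undoes 5/12.
  have hex : ∃ k, n ≤ N k := ⟨n, hkN n⟩
  have hk := Nat.find_spec hex
  have hmin : ∀ j, j < Nat.find hex → N j < n := fun j hj => not_le.1 (Nat.find_min hex hj)
  generalize Nat.find hex = k at hk hmin
  have h1 : φ n ≤ M * (1 / 4) ^ k := by
    cases k with
    | zero => simpa using hB' n
    | succ j => exact hN j n (hmin j (Nat.lt_succ_self j)).le
  have h2 := (hx k).trans (antitone_norm_pow_apply T hT x hk)
  rw [map_smul, norm_smul, Complex.norm_real, Real.norm_of_nonneg (by positivity)]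
  have h3 : 12 / 5 * M * (5 / 12 * (1 / 4) ^ k) ≤ 12 / 5 * M * ‖(T ^ n) x‖ := by gcongr
  linarith

/-- The rate 1/(n + 1) is already too slow, since (n + 1)‖T‖^n tends to 0. -/
theorem not_convergesArbitrarilySlowly_pow_of_norm_lt_one {H : Type*} [NormedAddCommGroup H]
    [InnerProductSpace ℂ H] (T : H →L[ℂ] H) (hT : ‖T‖ < 1) :
    ¬ ConvergesArbitrarilySlowly (fun n => T ^ n) 0 := by
  rintro ⟨-, h⟩
  obtain ⟨x, hx⟩ := h (fun n => 1 / ((n : ℝ) + 1)) (fun n => by positivity)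
    tendsto_one_div_add_atTop_nhds_zero_nat
  have h1 : Tendsto (fun n : ℕ => ((n : ℝ) * ‖T‖ ^ n + ‖T‖ ^ n) * ‖x‖) atTop
      (𝓝 ((0 + 0) * ‖x‖)) :=
    ((tendsto_self_mul_const_pow_of_lt_one (norm_nonneg T) hT).add
      (tendsto_pow_atTop_nhds_zero_of_lt_one (norm_nonneg T) hT)).mul_const _
  have h2 : ∀ n : ℕ, (1 : ℝ) ≤ ((n : ℝ) * ‖T‖ ^ n + ‖T‖ ^ n) * ‖x‖ := by
    intro n
    have h3 := hx n
    have h4 : ‖(T ^ n) x‖ ≤ ‖T‖ ^ n * ‖x‖ := by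
      induction n with
      | zero => simp
      | succ n ih =>
        rw [pow_succ', mul_apply_eq_comp, pow_succ', mul_assoc]
        exact T.le_opNorm_of_le (ih (hx n))
    simp only [zero_apply, sub_zero] at h3
    have h5 := h3.trans h4
    rw [div_le_iff₀ (by positivity)] at h5
    linarith
  have h6 := ge_of_tendsto' h1 h2
  norm_num at h6

end Slow

/-! ### Products of two projections -/

section Product

variable {H : Type*} [NormedAddCommGroup H] [InnerProductSpace ℂ H]
variable (K L : Submodule ℂ H) [K.HasOrthogonalProjection] [L.HasOrthogonalProjection]

theorem norm_starProjection_mul_le_one : ‖L.starProjection * K.starProjection‖ ≤ 1 :=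
  (norm_mul_le _ _).trans
    (mul_le_one₀ L.starProjection_norm_le (norm_nonneg _) K.starProjection_norm_le)

theorem norm_sub_starProjection_sq (x : H) :
    ‖x - K.starProjection x‖ ^ 2 = ‖x‖ ^ 2 - ‖K.starProjection x‖ ^ 2 := by
  have h := K.norm_sq_eq_add_norm_sq_starProjection x
  rw [← K.starProjection_orthogonal_val, h]
  ring

/-- Pythagoras for each of the two projections, then (s + t)² ≤ 2(s² + t²). Along an orbit the right
side telescopes. -/
theorem norm_sub_starProjection_mul_sq_le (x : H) :
    ‖x - (L.starProjection * K.starProjection) x‖ ^ 2 ≤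
      2 * (‖x‖ ^ 2 - ‖(L.starProjection * K.starProjection) x‖ ^ 2) := by
  have h1 := norm_sub_starProjection_sq K x
  have h2 := norm_sub_starProjection_sq L (K.starProjection x)
  have h3 : ‖x - L.starProjection (K.starProjection x)‖ ≤
      ‖x - K.starProjection x‖ + ‖K.starProjection x - L.starProjection (K.starProjection x)‖ :=
    norm_sub_le_norm_sub_add_norm_sub _ _ _
  rw [mul_apply_eq_comp]
  have h4 := pow_le_pow_left₀ (norm_nonneg _) h3 2
  nlinarith [sq_nonneg (‖x - K.starProjection x‖ -
    ‖K.starProjection x - L.starProjection (K.starProjection x)‖)]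

/-- Neither projection can shorten the vector, and a projection fixes any vector whose norm it
preserves. -/
theorem mem_inf_of_starProjection_starProjection_eq {x : H}
    (hx : L.starProjection (K.starProjection x) = x) : x ∈ K ⊓ L := by
  have hL : x ∈ L := hx ▸ L.starProjection_apply_mem _
  have hK : x ∈ K := by
    rw [K.mem_iff_norm_starProjection]
    refine le_antisymm (K.norm_starProjection_apply_le x) ?_
    conv_lhs => rw [← hx]
    exact L.norm_starProjection_apply_le _
  exact ⟨hK, hL⟩

/-- Von Neumann's theorem on alternating projections, for subspaces with trivial intersection. -/
theorem tendsto_starProjection_mul_pow [CompleteSpace H] (hKL : K ⊓ L = ⊥) (x : H) :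
    Tendsto (fun n => ((L.starProjection * K.starProjection) ^ n) x) atTop (𝓝 0) := by
  set T := L.starProjection * K.starProjection with hT
  have hT1 : ‖T‖ ≤ 1 := norm_starProjection_mul_le_one K L
  have hcon : ∀ (n : ℕ) (y : H), ‖(T ^ n) y‖ ≤ ‖y‖ := fun n y => by
    simpa using antitone_norm_pow_apply T hT1 y (Nat.zero_le n)
  -- The norms ‖T^n y‖ decrease to a limit, so the drops of their squares, which control T^n(y - T
  -- y), tend to 0.
  have hdiff : ∀ y, Tendsto (fun n => (T ^ n) (y - T y)) atTop (𝓝 0) := by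
    intro y
    have hconv := tendsto_atTop_ciInf (antitone_norm_pow_apply T hT1 y)
      ⟨0, by rintro _ ⟨n, rfl⟩; exact norm_nonneg _⟩
    have h0 : Tendsto (fun n => 2 * (‖(T ^ n) y‖ ^ 2 - ‖(T ^ (n + 1)) y‖ ^ 2)) atTop (𝓝 0) := by
      have h1 := ((hconv.pow 2).sub ((hconv.comp (tendsto_add_atTop_nat 1)).pow 2)).const_mul 2
      simpa using h1
    have h2 : ∀ n, ‖(T ^ n) (y - T y)‖ ^ 2 ≤ 2 * (‖(T ^ n) y‖ ^ 2 - ‖(T ^ (n + 1)) y‖ ^ 2) := by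
      intro n
      have h3 := norm_sub_starProjection_mul_sq_le K L ((T ^ n) y)
      rw [← hT] at h3
      have h4 : T ((T ^ n) y) = (T ^ (n + 1)) y := by rw [pow_succ']; rfl
      have h5 : (T ^ n) (y - T y) = (T ^ n) y - (T ^ (n + 1)) y := by
        rw [map_sub, pow_succ]; rfl
      rwa [h5, ← h4]
    have h6 := squeeze_zero (fun n => sq_nonneg _) h2 h0
    rw [tendsto_zero_iff_norm_tendsto_zero]
    simpa using h6.sqrt
  -- A vector orthogonal to the range of 1 - T is fixed by the adjoint P_K P_L, hence lies in K ∩ L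
  -- = 0.
  have hdense : Dense (Set.range (1 - T : H →L[ℂ] H)) := by
    have h1 : (1 - T : H →L[ℂ] H).rangeᗮ = ⊥ := by
      rw [Submodule.eq_bot_iff]
      intro y hy
      have h2 : ∀ z, inner ℂ z (y - K.starProjection (L.starProjection y)) = 0 := by
        intro z
        have h3 := (Submodule.mem_orthogonal _ _).1 hy ((1 - T) z) ⟨z, rfl⟩
        rw [inner_sub_right, ← K.inner_starProjection_left_eq_right,
          ← L.inner_starProjection_left_eq_right, ← inner_sub_left]
        exact h3
      have h4 : K.starProjection (L.starProjection y) = y :=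
        (sub_eq_zero.1 (inner_self_eq_zero.1 (h2 _))).symm
      have h5 := mem_inf_of_starProjection_starProjection_eq L K h4
      rw [inf_comm, hKL] at h5
      exact h5
    have h6 := (Submodule.topologicalClosure_eq_top_iff
      (K := (1 - T : H →L[ℂ] H).range)).2 h1
    exact Submodule.dense_iff_topologicalClosure_eq_top.2 h6
  rw [Metric.tendsto_atTop]
  intro ε hε
  obtain ⟨_, hy, ⟨y, rfl⟩⟩ := Metric.dense_iff.1 hdense x (ε / 2) (by positivity)
  obtain ⟨N, hN⟩ := Metric.tendsto_atTop.1 (hdiff y) (ε / 2) (by positivity)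
  refine ⟨N, fun n hn => ?_⟩
  have h1 := hN n hn
  rw [dist_zero_right] at h1 ⊢
  have h2 : (T ^ n) x = (T ^ n) (x - (y - T y)) + (T ^ n) (y - T y) := by
    rw [← map_add, sub_add_cancel]
  have h3 : ‖(T ^ n) (x - (y - T y))‖ < ε / 2 := by
    refine (hcon n _).trans_lt ?_
    rw [← dist_eq_norm, dist_comm]
    exact hy
  rw [h2]
  exact (norm_add_le _ _).trans_lt (by linarith)

/-- If the product has norm `1`, the two subspaces contain almost equal unit vectors. -/
theorem exists_norm_sub_starProjection_lt (h : ‖L.starProjection * K.starProjection‖ = 1)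
    {ε : ℝ} (hε : 0 < ε) :
    ∃ x ∈ K, ‖x‖ = 1 ∧ L.starProjection x ≠ 0 ∧ 1 - ε < ‖L.starProjection x‖ ∧
      ‖x - L.starProjection x‖ < ε := by
  -- The bound 1 - ε²/2 serves the distance: 1 - r² ≤ 2(1 - r) ≤ ε².
  set r : ℝ := max (max (1 - ε) (1 - ε ^ 2 / 2)) 0 with hr
  have hr1 : r < 1 := by
    rw [hr]
    have := pow_pos hε 2
    exact max_lt (max_lt (by linarith) (by linarith)) one_pos
  have hr0 : 0 ≤ r := le_max_right _ _
  have hre : 1 - ε ≤ r := (le_max_left _ _).trans (le_max_left _ _)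
  have hre2 : 1 - ε ^ 2 / 2 ≤ r := (le_max_right _ _).trans (le_max_left _ _)
  obtain ⟨z, hz⟩ : ∃ z, r * ‖z‖ < ‖(L.starProjection * K.starProjection) z‖ := by
    by_contra! h'
    have := ContinuousLinearMap.opNorm_le_bound _ hr0 h'
    linarith
  rw [mul_apply_eq_comp] at hz
  set u := K.starProjection z with hu
  have huz : ‖u‖ ≤ ‖z‖ := K.norm_starProjection_apply_le z
  have hu0 : 0 < ‖u‖ := by
    rcases eq_or_ne u 0 with h0 | h0
    · rw [h0, map_zero, norm_zero] at hz
      exact absurd hz (not_lt.2 (by positivity))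
    · exact norm_pos_iff.2 h0
  have hz' : r * ‖u‖ < ‖L.starProjection u‖ := lt_of_le_of_lt (by gcongr) hz
  set x : H := ((‖u‖⁻¹ : ℝ) : ℂ) • u with hx
  have hxn : ‖x‖ = 1 := by
    rw [hx, norm_smul, Complex.norm_real, norm_inv, norm_norm, inv_mul_cancel₀ hu0.ne']
  have hLx : r < ‖L.starProjection x‖ := by
    rw [hx, map_smul, norm_smul, Complex.norm_real, norm_inv, norm_norm, ← div_eq_inv_mul,
      lt_div_iff₀ hu0]
    exact hz'
  refine ⟨x, K.smul_mem _ (K.starProjection_apply_mem z), hxn,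
    norm_pos_iff.1 (hr0.trans_lt hLx), hre.trans_lt hLx, ?_⟩
  have h1 := norm_sub_starProjection_sq L x
  rw [hxn] at h1
  refine lt_of_pow_lt_pow_left₀ 2 hε.le ?_
  rw [h1]
  nlinarith

end Product

/-! ### Norm, spectrum, closed sums and the Friedrichs angle -/

section Equivalences

variable {H : Type*} [NormedAddCommGroup H] [InnerProductSpace ℂ H]

theorem exists_norm_le_mul_norm_apply_of_isUnit {S : H →L[ℂ] H} (hS : IsUnit S) :
    ∃ C > 0, ∀ x, ‖x‖ ≤ C * ‖S x‖ := by
  obtain ⟨u, rfl⟩ := hS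
  refine ⟨‖(↑u⁻¹ : H →L[ℂ] H)‖ + 1, by positivity, fun x => ?_⟩
  have h1 : (↑u⁻¹ : H →L[ℂ] H) ((u : H →L[ℂ] H) x) = x :=
    congrArg (fun f : H →L[ℂ] H => f x) u.inv_mul
  have h2 := (↑u⁻¹ : H →L[ℂ] H).le_opNorm ((u : H →L[ℂ] H) x)
  rw [h1] at h2
  linarith [norm_nonneg ((u : H →L[ℂ] H) x)]

variable (K L : Submodule ℂ H) [K.HasOrthogonalProjection] [L.HasOrthogonalProjection]

theorem norm_starProjection_mul_lt_one_iff :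
    ‖L.starProjection * K.starProjection‖ < 1 ↔ ‖L.starProjection * K.starProjection‖ ≠ 1 :=
  (norm_starProjection_mul_le_one K L).lt_iff_ne

/-- Neumann series in one direction; in the other, unit vectors of `K` almost in `L` show that 1 - T
is not bounded below. -/
theorem one_mem_spectrum_iff [CompleteSpace H] :
    (1 : ℂ) ∈ spectrum ℂ (L.starProjection * K.starProjection) ↔
      ‖L.starProjection * K.starProjection‖ = 1 := by
  rw [spectrum.mem_iff, map_one]
  constructor
  · intro h
    by_contra hne
    exact h (isUnit_one_sub_of_norm_lt_one ((norm_starProjection_mul_lt_one_iff K L).2 hne))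
  · intro h hu
    obtain ⟨C, hC, hb⟩ := exists_norm_le_mul_norm_apply_of_isUnit hu
    obtain ⟨x, hxK, hx1, -, -, hx⟩ := exists_norm_sub_starProjection_lt K L h
      (ε := 1 / C) (by positivity)
    have h2 : ‖x‖ ≤ C * ‖x - L.starProjection (K.starProjection x)‖ := hb x
    rw [K.starProjection_eq_self_iff.2 hxK, hx1] at h2
    rw [lt_div_iff₀ hC] at hx
    linarith

theorem one_le_norm_pow [CompleteSpace H] (h : ‖L.starProjection * K.starProjection‖ = 1)
    (n : ℕ) : 1 ≤ ‖(L.starProjection * K.starProjection) ^ n‖ := by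
  by_contra! hlt
  have h1 := spectrum.pow_mem_pow _ n ((one_mem_spectrum_iff K L).2 h)
  rw [one_pow, spectrum.mem_iff, map_one] at h1
  exact h1 (isUnit_one_sub_of_norm_lt_one hlt)

theorem convergesArbitrarilySlowly_pow_iff [CompleteSpace H] (hKL : K ⊓ L = ⊥) :
    ConvergesArbitrarilySlowly (fun n => (L.starProjection * K.starProjection) ^ n) 0 ↔
      ‖L.starProjection * K.starProjection‖ = 1 := by
  constructor
  · intro h
    by_contra hne
    exact not_convergesArbitrarilySlowly_pow_of_norm_lt_one _
      ((norm_starProjection_mul_lt_one_iff K L).2 hne) h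
  · refine fun h => ⟨fun x => tendsto_starProjection_mul_pow K L hKL x, fun φ _ hφ => ?_⟩
    obtain ⟨x, hx⟩ := exists_forall_le_norm_pow_apply _ h.le (one_le_norm_pow K L h) φ hφ
    exact ⟨x, fun n => by simpa using hx n⟩

/-- The sum is everything: 1 - T is onto, and x - T x = (x - P_K x) + (P_K x - P_L P_K x). -/
theorem isClosed_orthogonal_sup_of_norm_lt_one [CompleteSpace H]
    (h : ‖L.starProjection * K.starProjection‖ < 1) :
    IsClosed ((Kᗮ ⊔ Lᗮ : Submodule ℂ H) : Set H) := by
  have htop : Kᗮ ⊔ Lᗮ = ⊤ := by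
    rw [Submodule.eq_top_iff']
    intro y
    have hu := isUnit_one_sub_of_norm_lt_one h
    obtain ⟨x, rfl⟩ := (ContinuousLinearMap.isUnit_iff_bijective.1 hu).2 y
    have h1 : (1 - L.starProjection * K.starProjection) x =
        (x - K.starProjection x) + (K.starProjection x - L.starProjection (K.starProjection x)) := by
      rw [sub_add_sub_cancel]; rfl
    rw [h1]
    exact Submodule.add_mem_sup (K.sub_starProjection_mem_orthogonal x)
      (L.sub_starProjection_mem_orthogonal _)
  rw [htop]
  exact isClosed_univ

/-- The sum is dense, so if closed it is everything, and the open mapping theorem gives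
decompositions x = a + b with ‖b‖ ≤ C‖x‖. For a unit x ∈ K this yields 1 = ⟨x, b⟩ = ⟨x - P_L x, b⟩,
impossible when x is close to `L`. -/
theorem not_isClosed_orthogonal_sup_of_norm_eq_one [CompleteSpace H] (hKL : K ⊓ L = ⊥)
    (h : ‖L.starProjection * K.starProjection‖ = 1) :
    ¬ IsClosed ((Kᗮ ⊔ Lᗮ : Submodule ℂ H) : Set H) := by
  intro hcl
  have htop : Kᗮ ⊔ Lᗮ = ⊤ := by
    have h1 : (Kᗮ ⊔ Lᗮ)ᗮ = ⊥ := by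
      rw [← Submodule.inf_orthogonal, K.orthogonal_orthogonal, L.orthogonal_orthogonal, hKL]
    rw [← hcl.submodule_topologicalClosure_eq]
    exact Submodule.topologicalClosure_eq_top_iff.2 h1
  let f : (Kᗮ × Lᗮ) →L[ℂ] H := Kᗮ.subtypeL.coprod Lᗮ.subtypeL
  have hf : Function.Surjective f := by
    intro y
    have hy : y ∈ Kᗮ ⊔ Lᗮ := by rw [htop]; trivial
    obtain ⟨a, ha, b, hb, rfl⟩ := Submodule.mem_sup.1 hy
    exact ⟨(⟨a, ha⟩, ⟨b, hb⟩), rfl⟩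
  obtain ⟨C, hC, hpre⟩ := f.exists_preimage_norm_le hf
  obtain ⟨x, hxK, hx1, -, -, hx⟩ := exists_norm_sub_starProjection_lt K L h
    (ε := 1 / C) (by positivity)
  obtain ⟨⟨a, b⟩, hab, hn⟩ := hpre x
  have hab' : (a : H) + b = x := hab
  have hb : ‖(b : H)‖ ≤ C := by
    rw [hx1, mul_one] at hn
    exact (le_max_right ‖a‖ ‖b‖).trans hn
  have h1 : inner ℂ x x = inner ℂ (x - L.starProjection x) (b : H) := by
    have h2 : inner ℂ (L.starProjection x) (b : H) = 0 :=
      (Submodule.mem_orthogonal _ _).1 b.2 _ (L.starProjection_apply_mem x)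
    have h3 : inner ℂ x (a : H) = 0 := (Submodule.mem_orthogonal _ _).1 a.2 _ hxK
    rw [inner_sub_left, h2, sub_zero]
    calc inner ℂ x x = inner ℂ x ((a : H) + b) := by rw [hab']
      _ = inner ℂ x (b : H) := by rw [inner_add_right, h3, zero_add]
  have h4 : ‖inner ℂ x x‖ = 1 := by
    rw [inner_self_eq_norm_sq_to_K, hx1]; simp
  rw [h1] at h4
  have h5 := norm_inner_le_norm (𝕜 := ℂ) (x - L.starProjection x) (b : H)
  rw [lt_div_iff₀ hC] at hx
  have h6 : ‖x - L.starProjection x‖ * ‖(b : H)‖ ≤ ‖x - L.starProjection x‖ * C := by gcongr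
  linarith

theorem norm_inner_le_norm_starProjection_mul {x y : H} (hx : x ∈ K) (hy : y ∈ L) :
    ‖inner ℂ x y‖ ≤ ‖L.starProjection * K.starProjection‖ * ‖x‖ * ‖y‖ := by
  have h1 : inner ℂ x y = inner ℂ ((L.starProjection * K.starProjection) x) y := by
    rw [mul_apply_eq_comp, K.starProjection_eq_self_iff.2 hx,
      L.inner_starProjection_left_eq_right, L.starProjection_eq_self_iff.2 hy]
  rw [h1]
  exact (norm_inner_le_norm _ _).trans (by gcongr; exact ContinuousLinearMap.le_opNorm _ _)

theorem friedrichsCos_eq_one_iff (hKL : K ⊓ L = ⊥) :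
    friedrichsCos K L = 1 ↔ ‖L.starProjection * K.starProjection‖ = 1 := by
  unfold friedrichsCos
  rw [hKL, Submodule.bot_orthogonal_eq_top, inf_top_eq, inf_top_eq]
  set S : Set ℝ := {r : ℝ | ∃ x ∈ K, ∃ y ∈ L, ‖x‖ = 1 ∧ ‖y‖ = 1 ∧ r = ‖inner ℂ x y‖} with hS
  have hle : ∀ r ∈ S, r ≤ ‖L.starProjection * K.starProjection‖ := by
    rintro _ ⟨x, hx, y, hy, hx1, hy1, rfl⟩
    simpa [hx1, hy1] using norm_inner_le_norm_starProjection_mul K L hx hy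
  constructor
  · intro h
    refine le_antisymm (norm_starProjection_mul_le_one K L) ?_
    rw [← h]
    exact Real.sSup_le hle (norm_nonneg _)
  · intro h
    rw [h] at hle
    refine le_antisymm (Real.sSup_le hle zero_le_one) (le_of_forall_pos_lt_add fun ε hε => ?_)
    obtain ⟨x, hxK, hx1, hx0, hx, -⟩ := exists_norm_sub_starProjection_lt K L h hε
    have hp : 0 < ‖L.starProjection x‖ := norm_pos_iff.2 hx0
    have hmem : ‖L.starProjection x‖ ∈ S := by
      refine ⟨x, hxK, ((‖L.starProjection x‖⁻¹ : ℝ) : ℂ) • L.starProjection x,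
        L.smul_mem _ (L.starProjection_apply_mem x), hx1, ?_, ?_⟩
      · rw [norm_smul, Complex.norm_real, norm_inv, norm_norm, inv_mul_cancel₀ hp.ne']
      · have h1 : inner ℂ x (L.starProjection x) =
            inner ℂ (L.starProjection x) (L.starProjection x) := by
          rw [L.inner_starProjection_left_eq_right, L.starProjection_eq_self_iff.2
            (L.starProjection_apply_mem x)]
        rw [inner_smul_right, h1, inner_self_eq_norm_sq_to_K, norm_mul, norm_pow,
          Complex.norm_real, norm_inv, norm_norm]
        simp only [Complex.coe_algebraMap, Complex.norm_real, norm_norm]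
        field_simp
    have := le_csSup ⟨1, hle⟩ hmem
    linarith

theorem norm_le_of_mem_closure_numericalRange (T : H →L[ℂ] H) {z : ℂ}
    (hz : z ∈ closure (numericalRange T)) : ‖z‖ ≤ ‖T‖ := by
  have h : closure (numericalRange T) ⊆ Metric.closedBall 0 ‖T‖ := by
    refine closure_minimal ?_ Metric.isClosed_closedBall
    rintro _ ⟨x, hx, rfl⟩
    rw [mem_closedBall_zero_iff]
    refine (norm_inner_le_norm _ _).trans ?_
    simpa [hx] using T.le_opNorm x
  simpa using h hz

end Equivalences

/-! ### Sectors and ellipses -/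

section Plane

/-- For w = 1 - z the hypothesis says ‖w‖ sin(|arg w| - θ) ≤ 0. Unlike the condition on arg, it is
visibly closed in z. -/
theorem mem_sectorAtOne_of_abs_im_mul_cos_le {θ : ℝ} (hθ : 0 < θ) {z : ℂ}
    (h : |(1 - z).im| * Real.cos θ ≤ (1 - z).re * Real.sin θ) : z ∈ sectorAtOne θ := by
  by_contra hz
  have hz' : θ < |Complex.arg (1 - z)| := not_le.1 hz
  generalize 1 - z = w at h hz'
  have hw0 : w ≠ 0 := by
    rintro rfl
    simp only [Complex.arg_zero, abs_zero] at hz'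
    linarith
  have hsin : 0 < Real.sin (|Complex.arg w| - θ) :=
    Real.sin_pos_of_pos_of_lt_pi (by linarith) (by linarith [Complex.abs_arg_le_pi w])
  have hre : w.re = ‖w‖ * Real.cos |Complex.arg w| := by
    rw [Real.cos_abs, Complex.norm_mul_cos_arg]
  have him : |w.im| = ‖w‖ * Real.sin |Complex.arg w| := by
    rw [← Real.abs_sin_eq_sin_abs_of_abs_le_pi (Complex.abs_arg_le_pi w),
      ← Complex.norm_mul_sin_arg w, abs_mul, abs_norm]
  rw [Real.sin_sub] at hsin
  rw [hre, him] at h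
  have := mul_pos (norm_pos_iff.2 hw0) hsin
  linarith

theorem abs_im_mul_cos_le_of_mem_sectorAtOne {θ : ℝ} (hθ : θ ≤ Real.pi) {z : ℂ}
    (h : z ∈ sectorAtOne θ) : |(1 - z).im| * Real.cos θ ≤ (1 - z).re * Real.sin θ := by
  have hz' : |Complex.arg (1 - z)| ≤ θ := h
  generalize 1 - z = w at hz'
  have hsin : 0 ≤ Real.sin (θ - |Complex.arg w|) :=
    Real.sin_nonneg_of_nonneg_of_le_pi (by linarith) (by linarith [abs_nonneg (Complex.arg w)])
  have hre : w.re = ‖w‖ * Real.cos |Complex.arg w| := by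
    rw [Real.cos_abs, Complex.norm_mul_cos_arg]
  have him : |w.im| = ‖w‖ * Real.sin |Complex.arg w| := by
    rw [← Real.abs_sin_eq_sin_abs_of_abs_le_pi (Complex.abs_arg_le_pi w),
      ← Complex.norm_mul_sin_arg w, abs_mul, abs_norm]
  rw [Real.sin_sub] at hsin
  rw [hre, him]
  have := mul_nonneg (norm_nonneg w) hsin
  linarith

theorem mem_ellipse_iff {l : ℝ} (h0 : 0 ≤ l) (h1 : l ≤ 1) {z : ℂ} :
    z ∈ ellipse l ↔ ‖z‖ + ‖z - l‖ ≤ Real.sqrt l := by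
  have h : dist (0 : ℂ) l ^ 2 + Real.sqrt (l * (1 - l)) ^ 2 = l := by
    rw [Real.sq_sqrt (mul_nonneg h0 (by linarith)), dist_zero_left, Complex.norm_real,
      Real.norm_of_nonneg h0]
    ring
  unfold ellipse ellipseDomain
  rw [Set.mem_ofPred_eq, h, dist_zero_right, dist_eq_norm]

theorem ofReal_mem_ellipse {l : ℝ} (h0 : 0 ≤ l) (h1 : l ≤ 1) : (l : ℂ) ∈ ellipse l := by
  rw [mem_ellipse_iff h0 h1, sub_self, norm_zero, add_zero, Complex.norm_real,
    Real.norm_of_nonneg h0]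
  exact Real.le_sqrt_of_sq_le (by nlinarith)

/-- The point of contact of the ellipse with the tangent from `1` into the upper half plane. -/
theorem tangentPoint_mem_ellipse {l : ℝ} (h0 : 0 ≤ l) (h1 : l ≤ 1) :
    (⟨l * (3 - l) / (2 * (2 - l)), (1 - l) * Real.sqrt (l * (4 - l)) / (2 * (2 - l))⟩ : ℂ) ∈
      ellipse l := by
  have h2 : 0 < 2 - l := by linarith
  have hs : Real.sqrt (l * (4 - l)) ^ 2 = l * (4 - l) :=
    Real.sq_sqrt (mul_nonneg h0 (by linarith))
  have hl : Real.sqrt l ^ 2 = l := Real.sq_sqrt h0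
  rw [mem_ellipse_iff h0 h1]
  -- The focal distances √l/(2 - l) and √l(1 - l)/(2 - l) add up to exactly √l.
  have e1 : ‖(⟨l * (3 - l) / (2 * (2 - l)),
      (1 - l) * Real.sqrt (l * (4 - l)) / (2 * (2 - l))⟩ : ℂ)‖ = Real.sqrt l / (2 - l) := by
    rw [← sq_eq_sq₀ (norm_nonneg _) (by positivity), Complex.sq_norm, Complex.normSq_mk, div_pow,
      hl]
    field_simp
    ring_nf at hs ⊢
    rw [hs]
    ring
  have e2 : ‖(⟨l * (3 - l) / (2 * (2 - l)),
      (1 - l) * Real.sqrt (l * (4 - l)) / (2 * (2 - l))⟩ : ℂ) - l‖ =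
      Real.sqrt l * (1 - l) / (2 - l) := by
    have h3 : 0 ≤ 1 - l := by linarith
    rw [← sq_eq_sq₀ (norm_nonneg _) (by positivity), Complex.sq_norm, Complex.normSq_apply,
      div_pow, mul_pow, hl]
    simp only [Complex.sub_re, Complex.sub_im, Complex.ofReal_re, Complex.ofReal_im, sub_zero]
    field_simp
    ring_nf at hs ⊢
    rw [hs]
    ring
  rw [e1, e2, ← add_div, div_le_iff₀ h2]
  linarith

/-- Every point of the ellipse with foci `0` and `l` is the value of the quadratic form of the
matrix `!![l, √(l (1 - l)); 0, 0]` at some unit vector. -/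
theorem exists_eq_of_mem_ellipse {l : ℝ} (h0 : 0 < l) (h1 : l < 1) {z : ℂ} (hz : z ∈ ellipse l) :
    ∃ (a : ℝ) (b : ℂ), a ^ 2 + ‖b‖ ^ 2 = 1 ∧
      z = l * a ^ 2 + Real.sqrt (l * (1 - l)) * a * b := by
  rw [mem_ellipse_iff h0.le h1.le] at hz
  set m := Real.sqrt (l * (1 - l)) with hm
  have hm0 : 0 < m := Real.sqrt_pos.2 (mul_pos h0 (by linarith))
  have hm2 : m ^ 2 = l * (1 - l) := Real.sq_sqrt (mul_nonneg h0.le (by linarith))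
  have hl : Real.sqrt l ^ 2 = l := Real.sq_sqrt h0.le
  have hl0 : 0 < Real.sqrt l := Real.sqrt_pos.2 h0
  have n1 : ‖z‖ ^ 2 = z.re ^ 2 + z.im ^ 2 := by rw [Complex.sq_norm, Complex.normSq_apply]; ring
  have n2 : ∀ t : ℝ, ‖z - t‖ ^ 2 = (z.re - t) ^ 2 + z.im ^ 2 := fun t => by
    rw [Complex.sq_norm, Complex.normSq_apply]
    simp only [Complex.sub_re, Complex.sub_im, Complex.ofReal_re, Complex.ofReal_im, sub_zero]
    ring
  -- Squaring twice removes the norms and leaves the Cartesian equation `key3` of the ellipse.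
  have key1 : 2 * ‖z - l‖ ≤ Real.sqrt l * (1 + l - 2 * z.re) := by
    have h2 : ‖z‖ ^ 2 ≤ (Real.sqrt l - ‖z - l‖) ^ 2 :=
      pow_le_pow_left₀ (norm_nonneg _) (by linarith) 2
    have h3 := n2 l
    have h4 : 2 * Real.sqrt l * ‖z - l‖ ≤ l * (1 + l - 2 * z.re) := by nlinarith
    refine le_of_mul_le_mul_left ?_ hl0
    calc Real.sqrt l * (2 * ‖z - l‖) = 2 * Real.sqrt l * ‖z - l‖ := by ring
      _ ≤ l * (1 + l - 2 * z.re) := h4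
      _ = Real.sqrt l * (Real.sqrt l * (1 + l - 2 * z.re)) := by rw [← mul_assoc, ← sq, hl]
  have key2 : 4 * ((z.re - l) ^ 2 + z.im ^ 2) ≤ l * (1 + l - 2 * z.re) ^ 2 := by
    have h2 := pow_le_pow_left₀ (mul_nonneg zero_le_two (norm_nonneg _)) key1 2
    rw [mul_pow, mul_pow, hl, n2] at h2
    linarith
  have key3 : (1 - l) * (2 * z.re - l) ^ 2 + 4 * z.im ^ 2 ≤ (1 - l) * l := by linarith
  have hX : (2 * z.re - l) ^ 2 ≤ 1 := by
    refine le_trans (le_of_mul_le_mul_left ?_ (sub_pos.2 h1)) h1.le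
    linarith [sq_nonneg z.im]
  obtain ⟨hX1, hX2⟩ := abs_le.1 ((sq_le_one_iff_abs_le_one _).1 hX)
  -- With c = 2a² - 1, the values for fixed a form the circle of centre l(1 + c)/2 and radius m√(1 -
  -- c²)/2. The expression is |z|² ≥ 0 at c = -1, and at its minimiser c = 2 Re z - l it is ≤ 0 by
  -- `key3`.
  obtain ⟨c, ⟨hc1, hc2⟩, hc⟩ : ∃ c ∈ Set.Icc (-1) (2 * z.re - l),
      (z.re - l * (1 + c) / 2) ^ 2 + z.im ^ 2 - m ^ 2 * (1 - c ^ 2) / 4 = 0 := by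
    have hcont : ContinuousOn (fun c : ℝ =>
        (z.re - l * (1 + c) / 2) ^ 2 + z.im ^ 2 - m ^ 2 * (1 - c ^ 2) / 4)
        (Set.Icc (-1) (2 * z.re - l)) := by fun_prop
    refine intermediate_value_Icc' hX1 hcont ⟨?_, ?_⟩
    · rw [hm2]
      linarith
    · linarith [sq_nonneg z.re, sq_nonneg z.im]
  have hc3 : c ≤ 1 := hc2.trans hX2
  have ha2 : Real.sqrt ((1 + c) / 2) ^ 2 = (1 + c) / 2 := Real.sq_sqrt (by linarith)
  rcases eq_or_lt_of_le hc1 with rfl | hc1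
  · refine ⟨0, 1, by simp, ?_⟩
    have h2 : ‖z‖ ^ 2 = 0 := by
      rw [n1]
      linarith
    simpa using h2
  · set a := Real.sqrt ((1 + c) / 2) with ha
    have ha0 : 0 < a := Real.sqrt_pos.2 (by linarith)
    refine ⟨a, (z - (l * a ^ 2 : ℝ)) / (m * a : ℝ), ?_, ?_⟩
    · rw [norm_div, div_pow, n2, Complex.norm_real, Real.norm_of_nonneg (by positivity), mul_pow,
        ha2]
      have h2 : (z.re - l * ((1 + c) / 2)) ^ 2 + z.im ^ 2 = m ^ 2 * (1 - c ^ 2) / 4 := by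
        rw [← mul_div_assoc]
        linarith
      have h3 : 0 < 1 + c := by linarith
      rw [h2]
      field_simp
      ring
    · have h2 : (m : ℂ) * a ≠ 0 := by
        exact_mod_cast (mul_pos hm0 ha0).ne'
      push_cast
      rw [mul_div_cancel₀ _ h2]
      ring

/-- The contact points of the tangents from 1 force tan θ ≥ √(l/(4 - l)), whose limit as l → 1 is
1/√3 = tan(π/6). -/
theorem not_ellipse_subset_sectorAtOne {W : Set ℂ} {l : ℕ → ℝ} (hl : ∀ n, l n ∈ Set.Ico (0 : ℝ) 1)
    (hlim : Tendsto l atTop (𝓝 1)) (hW : ∀ n, ellipse (l n) ⊆ closure W) :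
    ¬ ∃ θ : ℝ, θ < Real.pi / 6 ∧ W ⊆ sectorAtOne θ := by
  rintro ⟨θ, hθ, hs⟩
  have hpi := Real.pi_pos
  have hne : W.Nonempty :=
    closure_nonempty_iff.1 ⟨_, hW 0 (ofReal_mem_ellipse (hl 0).1 (hl 0).2.le)⟩
  obtain ⟨w, hw⟩ := hne
  have hθ0 : 0 ≤ θ := (abs_nonneg _).trans (hs hw)
  have hsub : closure W ⊆ {z : ℂ | |(1 - z).im| * Real.cos θ ≤ (1 - z).re * Real.sin θ} := by
    refine closure_minimal
      (fun z hz => abs_im_mul_cos_le_of_mem_sectorAtOne (by linarith) (hs hz)) ?_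
    exact isClosed_le (by fun_prop) (by fun_prop)
  have hkey : ∀ n, Real.sqrt (l n * (4 - l n)) * Real.cos θ ≤ (4 - l n) * Real.sin θ := by
    intro n
    obtain ⟨h0, h1⟩ := hl n
    have h2 := hsub (hW n (tangentPoint_mem_ellipse h0 h1.le))
    generalize l n = t at h0 h1 h2
    have h3 : 0 < 1 - t := by linarith
    have h4 : 0 < 2 - t := by linarith
    simp only [Set.mem_ofPred_eq, Complex.sub_im, Complex.one_im, zero_sub, abs_neg, Complex.sub_re,
      Complex.one_re] at h2
    rw [abs_of_nonneg (by positivity)] at h2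
    have e : 1 - t * (3 - t) / (2 * (2 - t)) = (1 - t) * (4 - t) / (2 * (2 - t)) := by
      field_simp
      ring
    rw [e, div_mul_eq_mul_div, div_mul_eq_mul_div,
      div_le_div_iff_of_pos_right (by positivity), mul_assoc, mul_assoc] at h2
    exact le_of_mul_le_mul_left h2 h3
  have hA : Tendsto (fun n => Real.sqrt (l n * (4 - l n)) * Real.cos θ) atTop
      (𝓝 (Real.sqrt (1 * (4 - 1)) * Real.cos θ)) :=
    (hlim.mul (hlim.const_sub 4)).sqrt.mul_const _
  have hB : Tendsto (fun n => (4 - l n) * Real.sin θ) atTop (𝓝 ((4 - 1) * Real.sin θ)) :=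
    (hlim.const_sub 4).mul_const _
  have h := le_of_tendsto_of_tendsto' hA hB hkey
  have hsin : Real.sin θ < 1 / 2 := by
    rw [← Real.sin_pi_div_six]
    exact Real.sin_lt_sin_of_lt_of_le_pi_div_two (by linarith) (by linarith) hθ
  have hcos : Real.sqrt 3 / 2 < Real.cos θ := by
    rw [← Real.cos_pi_div_six]
    exact Real.cos_lt_cos_of_nonneg_of_le_pi_div_two hθ0 (by linarith) hθ
  have h3 : Real.sqrt 3 ^ 2 = 3 := Real.sq_sqrt (by norm_num)
  have h30 : 0 < Real.sqrt 3 := by positivity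
  norm_num at h
  nlinarith

end Plane

/-! ### A sector containing the numerical range -/

section Sector

/-- Here `p` and `q` are the real and imaginary parts of the scalar product of two vectors whose
norms have product `s`. -/
theorem mul_add_mul_le_of_gram {k C s p q : ℝ} (hk : 0 < k) (hk1 : k < 1 / 2)
    (hC : k ^ 2 + C ^ 2 = 1) (hs : 0 < s) (h1 : p ^ 2 + q ^ 2 ≤ 4 * k ^ 2 * s ^ 2)
    (h2 : p ^ 2 + q ^ 2 ≤ s ^ 2 * (1 - 2 * s + 2 * p)) : q * C + p * k ≤ k := by
  obtain ⟨P, rfl⟩ : ∃ P, p = s * P := ⟨p / s, by field_simp⟩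
  obtain ⟨Q, rfl⟩ : ∃ Q, q = s * Q := ⟨q / s, by field_simp⟩
  have hs2 : 0 < s ^ 2 := by positivity
  have h1' : P ^ 2 + Q ^ 2 ≤ 4 * k ^ 2 := le_of_mul_le_mul_left (by linarith) hs2
  have h2' : P ^ 2 + Q ^ 2 ≤ 1 - 2 * s + 2 * (s * P) := le_of_mul_le_mul_left (by linarith) hs2
  -- Now `h2'` reads 2s(1 - P) ≤ 1 - R. If QC + Pk > 0, it suffices that (1 - R)(QC + Pk) ≤ 2k(1 -
  -- P), which rearranges to the upper bound in `hcs`.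
  set R := P ^ 2 + Q ^ 2 with hR
  have hR1 : R < 1 := by nlinarith
  have hP : P < 1 := by nlinarith [sq_nonneg Q]
  rcases le_or_gt (Q * C + P * k) 0 with hneg | hpos
  · nlinarith
  -- Cauchy–Schwarz; the excess over 4k² factors as (R - 4k²)(1 - R)² ≤ 0.
  have hcs : (Q * (C * (1 - R)) + P * (k * (3 - R))) ^ 2 ≤ (2 * k) ^ 2 := by
    have h3 : (Q * (C * (1 - R)) + P * (k * (3 - R))) ^ 2 ≤
        R * ((C * (1 - R)) ^ 2 + (k * (3 - R)) ^ 2) := by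
      rw [hR]
      nlinarith [sq_nonneg (Q * (k * (3 - R)) - P * (C * (1 - R)))]
    have h4 : R * ((C * (1 - R)) ^ 2 + (k * (3 - R)) ^ 2) - (2 * k) ^ 2 =
        (R - 4 * k ^ 2) * (1 - R) ^ 2 := by
      rw [mul_pow, eq_sub_of_add_eq' hC]
      ring
    have h5 : (R - 4 * k ^ 2) * (1 - R) ^ 2 ≤ 0 :=
      mul_nonpos_of_nonpos_of_nonneg (by linarith) (sq_nonneg _)
    linarith
  have hcs' := abs_le_of_sq_le_sq' hcs (by linarith)
  have h6 : 2 * s * (1 - P) * (Q * C + P * k) ≤ (1 - R) * (Q * C + P * k) := by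
    gcongr
    linarith
  have h7 : 2 * (1 - P) * (s * (Q * C + P * k)) ≤ 2 * (1 - P) * k := by linarith [hcs'.2]
  have h8 := le_of_mul_le_mul_left h7 (by linarith)
  linarith

variable {H : Type*} [NormedAddCommGroup H] [InnerProductSpace ℂ H]
variable (K L : Submodule ℂ H) [K.HasOrthogonalProjection] [L.HasOrthogonalProjection]

theorem inner_starProjection_mul_self (x : H) :
    inner ℂ x ((L.starProjection * K.starProjection) x) =
      inner ℂ (L.starProjection x) (K.starProjection x) := by
  rw [mul_apply_eq_comp, L.inner_starProjection_left_eq_right]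

theorem inner_self_starProjection (x : H) :
    inner ℂ x (K.starProjection x) = ((‖K.starProjection x‖ ^ 2 : ℝ) : ℂ) := by
  conv_lhs => rw [← K.starProjection_eq_self_iff.2 (K.starProjection_apply_mem x),
    ← K.inner_starProjection_left_eq_right]
  rw [inner_self_eq_norm_sq_to_K]
  simp

/-- This is the nonnegativity of the Gram determinant of x, P_K x, P_L x, in which ⟨x, P x⟩ = ‖P x‖²
for both projections. -/
theorem norm_inner_starProjection_sq_le {x : H} (hx : ‖x‖ = 1) :
    ‖inner ℂ (L.starProjection x) (K.starProjection x)‖ ^ 2 ≤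
      ‖K.starProjection x‖ ^ 2 * ‖L.starProjection x‖ ^ 2 *
        (1 - ‖K.starProjection x‖ ^ 2 - ‖L.starProjection x‖ ^ 2 +
          2 * (inner ℂ (L.starProjection x) (K.starProjection x)).re) := by
  have hxu := inner_self_starProjection K x
  have hxv := inner_self_starProjection L x
  have hxsub := norm_sub_starProjection_sq K x
  set u := K.starProjection x
  set v := L.starProjection x
  set w : ℂ := inner ℂ v u with hw
  have hwc : inner ℂ u v = (starRingEnd ℂ) w := (inner_conj_symm u v).symm
  have huu : inner ℂ u u = ((‖u‖ ^ 2 : ℝ) : ℂ) := by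
    rw [inner_self_eq_norm_sq_to_K]; simp
  have hvv : inner ℂ v v = ((‖v‖ ^ 2 : ℝ) : ℂ) := by
    rw [inner_self_eq_norm_sq_to_K]; simp
  rcases eq_or_ne u 0 with h0 | h0
  · have : w = 0 := by rw [hw, h0, inner_zero_right]
    rw [this, h0]; simp
  have ha : 0 < ‖u‖ := norm_pos_iff.2 h0
  rw [hx, one_pow] at hxsub
  set A : ℝ := ‖u‖ ^ 2 with hA
  have hA0 : 0 < A := by positivity
  set B : ℝ := ‖v‖ ^ 2 with hB
  -- Up to the factor A, the component of v orthogonal to u; Cauchy–Schwarz is applied to it and x -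
  -- u, the corresponding component of x.
  set g : H := (A : ℂ) • v - (starRingEnd ℂ) w • u with hg
  have hin : inner ℂ (x - u) g = (A : ℂ) * (B - (starRingEnd ℂ) w) := by
    simp only [hg, inner_sub_left, inner_sub_right, inner_smul_right, hxu, hxv, hwc, huu]
    ring
  have hgn : ‖g‖ ^ 2 = A * (A * B - ‖w‖ ^ 2) := by
    have h1 : inner ℂ g g = ((A * (A * B - ‖w‖ ^ 2) : ℝ) : ℂ) := by
      have h2 : (w : ℂ) * (starRingEnd ℂ) w = ((‖w‖ ^ 2 : ℝ) : ℂ) := by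
        rw [Complex.mul_conj, Complex.normSq_eq_norm_sq]
      simp only [hg, inner_sub_left, inner_sub_right, inner_smul_right, inner_smul_left, hwc, huu,
        hvv, Complex.conj_conj, Complex.conj_ofReal, ← hw]
      push_cast at h2 ⊢
      rw [← h2]
      ring
    rw [inner_self_eq_norm_sq_to_K] at h1
    exact Complex.ofReal_injective (by rw [← h1]; simp)
  have hcs := norm_inner_le_norm (𝕜 := ℂ) (x - u) g
  have hcs2 := pow_le_pow_left₀ (norm_nonneg _) hcs 2
  rw [hin, mul_pow, hxsub, hgn, norm_mul, mul_pow, Complex.norm_real,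
    Real.norm_of_nonneg hA0.le] at hcs2
  have hBw : ‖(B : ℂ) - (starRingEnd ℂ) w‖ ^ 2 = B ^ 2 - 2 * B * w.re + ‖w‖ ^ 2 := by
    rw [Complex.sq_norm, Complex.sq_norm, Complex.normSq_apply, Complex.normSq_apply]
    simp only [Complex.sub_re, Complex.sub_im, Complex.ofReal_re, Complex.ofReal_im,
      Complex.conj_re, Complex.conj_im]
    ring
  rw [hBw] at hcs2
  have h3 : A * (A * (B ^ 2 - 2 * B * w.re + ‖w‖ ^ 2)) ≤
      A * ((1 - A) * (A * B - ‖w‖ ^ 2)) := by linarith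
  have h4 := le_of_mul_le_mul_left h3 hA0
  linarith

/-- If the product of two projections has norm `c < 1`, its numerical range lies in a sector with
vertex `1` and half-angle less than `π / 6`. -/
theorem exists_numericalRange_subset_sectorAtOne
    (h : ‖L.starProjection * K.starProjection‖ < 1) :
    ∃ θ : ℝ, θ < Real.pi / 6 ∧
      numericalRange (L.starProjection * K.starProjection) ⊆ sectorAtOne θ := by
  set c := ‖L.starProjection * K.starProjection‖ with hc
  obtain ⟨k, hk0, hk1, hck⟩ : ∃ k : ℝ, 0 < k ∧ k < 1 / 2 ∧ c ≤ 2 * k :=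
    ⟨(c + 1) / 4, by positivity, by linarith, by linarith⟩
  have hc0 : 0 ≤ c := norm_nonneg _
  have hsin : Real.sin (Real.arcsin k) = k := Real.sin_arcsin (by linarith) (by linarith)
  refine ⟨Real.arcsin k, ?_, ?_⟩
  · rw [Real.arcsin_lt_iff_lt_sin' ⟨by linarith [Real.pi_pos], by linarith [Real.pi_pos]⟩,
      Real.sin_pi_div_six]
    exact hk1
  rintro _ ⟨x, hx, rfl⟩
  refine mem_sectorAtOne_of_abs_im_mul_cos_le (Real.arcsin_pos.2 hk0) ?_
  have hC := Real.sin_sq_add_cos_sq (Real.arcsin k)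
  rw [hsin] at hC ⊢
  rw [inner_starProjection_mul_self]
  have hg := norm_inner_starProjection_sq_le K L hx
  have hn := norm_inner_le_norm_starProjection_mul K L (K.starProjection_apply_mem x)
    (L.starProjection_apply_mem x)
  rw [← hc, norm_inner_symm] at hn
  generalize Real.cos (Real.arcsin k) = C at hC
  generalize inner ℂ (L.starProjection x) (K.starProjection x) = w at hg hn
  have ha := norm_nonneg (K.starProjection x)
  have hb := norm_nonneg (L.starProjection x)
  generalize ‖K.starProjection x‖ = a at hg hn ha
  generalize ‖L.starProjection x‖ = b at hg hn hb
  simp only [Complex.sub_im, Complex.one_im, zero_sub, abs_neg, Complex.sub_re, Complex.one_re]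
  rcases eq_or_lt_of_le (mul_nonneg ha hb) with hs | hs
  · have : w = 0 := by
      rw [mul_assoc, ← hs, mul_zero] at hn
      exact norm_le_zero_iff.1 hn
    rw [this]
    simpa using hk0.le
  have hw : ‖w‖ ^ 2 = w.re ^ 2 + |w.im| ^ 2 := by
    rw [Complex.sq_norm, Complex.normSq_apply, sq_abs]; ring
  have h1 : w.re ^ 2 + |w.im| ^ 2 ≤ 4 * k ^ 2 * (a * b) ^ 2 := by
    rw [← hw]
    calc ‖w‖ ^ 2 ≤ (2 * k * (a * b)) ^ 2 :=
          pow_le_pow_left₀ (norm_nonneg _) (hn.trans (by rw [mul_assoc]; gcongr)) 2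
      _ = 4 * k ^ 2 * (a * b) ^ 2 := by ring
  -- The inequality 2ab ≤ a² + b² leaves only the product ab.
  have h2 : w.re ^ 2 + |w.im| ^ 2 ≤ (a * b) ^ 2 * (1 - 2 * (a * b) + 2 * w.re) := by
    rw [← hw]
    refine hg.trans ?_
    rw [← mul_pow]
    refine mul_le_mul_of_nonneg_left ?_ (sq_nonneg _)
    linarith [two_mul_le_add_sq a b]
  have h3 := mul_add_mul_le_of_gram hk0 hk1 hC hs h1 h2
  linarith

end Sector

/-! ### Ellipses contained in the closure of the numerical range -/

section Ellipses

variable {H : Type*} [NormedAddCommGroup H] [InnerProductSpace ℂ H]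

/-- A point of the spectrum of a self-adjoint operator is an approximate eigenvalue. -/
theorem exists_norm_apply_sub_smul_lt [CompleteSpace H] {A : H →L[ℂ] H} (hA : IsSelfAdjoint A)
    {l : ℝ} (hl : l ∈ spectrum ℝ A) {ε : ℝ} (hε : 0 < ε) :
    ∃ x, ‖A x - (l : ℂ) • x‖ < ε * ‖x‖ := by
  by_contra! h
  rw [spectrum.mem_iff] at hl
  apply hl
  set B : H →L[ℂ] H := algebraMap ℝ (H →L[ℂ] H) l - A with hB
  have hBsa : IsSelfAdjoint B := (IsSelfAdjoint.algebraMap _ (IsSelfAdjoint.all l)).sub hA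
  have hBx : ∀ x, ε * ‖x‖ ≤ ‖B x‖ := by
    intro x
    have h1 : B x = -(A x - (l : ℂ) • x) := by
      rw [neg_sub, hB, Algebra.algebraMap_eq_smul_one]
      simp
    rw [h1, norm_neg]
    exact h x
  -- `B` is bounded below, and its range is dense because the orthogonal complement is the kernel of
  -- the self-adjoint `B`.
  rw [ContinuousLinearMap.isUnit_iff_bijective,
    ContinuousLinearMap.bijective_iff_dense_range_and_antilipschitz]
  refine ⟨?_, _, B.antilipschitz_of_bound (K := Real.toNNReal ε⁻¹) fun x => ?_⟩
  · rw [Submodule.topologicalClosure_eq_top_iff, ContinuousLinearMap.IsStarNormal.orthogonal_range hBsa.isStarNormal,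
      Submodule.eq_bot_iff]
    intro x hx
    have h1 := hBx x
    rw [show B x = 0 from hx, norm_zero] at h1
    exact norm_le_zero_iff.1 (nonpos_of_mul_nonpos_right h1 hε)
  · rw [Real.coe_toNNReal _ (by positivity), ← div_eq_inv_mul, le_div_iff₀ hε, mul_comm]
    exact hBx x

theorem mem_closure_numericalRange_of_tendsto (T : H →L[ℂ] H) {y : ℕ → H} {z : ℂ}
    (h1 : Tendsto (fun n => inner ℂ (y n) (y n)) atTop (𝓝 1))
    (h2 : Tendsto (fun n => inner ℂ (y n) (T (y n))) atTop (𝓝 z)) :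
    z ∈ closure (numericalRange T) := by
  have h3 := h2.div h1 one_ne_zero
  rw [div_one] at h3
  refine mem_closure_of_tendsto h3 ?_
  filter_upwards [h1.eventually_ne one_ne_zero] with n hn
  have hy : y n ≠ 0 := fun h => hn (by rw [h, inner_zero_left])
  have hp : 0 < ‖y n‖ := norm_pos_iff.2 hy
  refine ⟨((‖y n‖⁻¹ : ℝ) : ℂ) • y n, ?_, ?_⟩
  · rw [norm_smul, Complex.norm_real, norm_inv, norm_norm, inv_mul_cancel₀ hp.ne']
  · have hp' : ((‖y n‖ : ℝ) : ℂ) ≠ 0 := by exact_mod_cast hp.ne'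
    rw [map_smul, inner_smul_left, inner_smul_right, Complex.conj_ofReal, Pi.div_apply,
      inner_self_eq_norm_sq_to_K]
    simp only [Complex.ofReal_inv, Complex.coe_algebraMap]
    field_simp

variable (K L : Submodule ℂ H) [K.HasOrthogonalProjection] [L.HasOrthogonalProjection]

theorem isSelfAdjoint_starProjection_mul_mul [CompleteSpace H] :
    IsSelfAdjoint (K.starProjection * L.starProjection * K.starProjection) := by
  have h := (isSelfAdjoint_starProjection L).conjugate K.starProjection
  rwa [(isSelfAdjoint_starProjection K).star_eq] at h

/-- If the subspaces have trivial intersection and the product of the projections has norm `1`,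
then `1` is a limit point of the spectrum of the associated positive operator. -/
theorem exists_mem_spectrum_lt_one [CompleteSpace H] (hKL : K ⊓ L = ⊥)
    (h : ‖L.starProjection * K.starProjection‖ = 1) {δ : ℝ} (hδ : 0 < δ) :
    ∃ l ∈ spectrum ℝ (K.starProjection * L.starProjection * K.starProjection),
      1 - δ < l ∧ l < 1 := by
  by_contra! hno
  have hsa := isSelfAdjoint_starProjection_mul_mul K L
  have hAapp : ∀ x, (K.starProjection * L.starProjection * K.starProjection) x =
      K.starProjection (L.starProjection (K.starProjection x)) := fun x => rfl
  have hnorm : ‖K.starProjection * L.starProjection * K.starProjection‖ ≤ 1 := by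
    rw [mul_assoc]
    exact (norm_mul_le _ _).trans (mul_le_one₀ K.starProjection_norm_le (norm_nonneg _) h.le)
  set A := K.starProjection * L.starProjection * K.starProjection with hA
  have hone : (1 : ℝ) ∈ spectrum ℝ A := by
    rw [spectrum.mem_iff, map_one]
    intro hu
    obtain ⟨C, hC, hb⟩ := exists_norm_le_mul_norm_apply_of_isUnit hu
    obtain ⟨x, hxK, hx1, -, -, hx⟩ := exists_norm_sub_starProjection_lt K L h
      (ε := 1 / C) (by positivity)
    have h2 : ‖x‖ ≤ C * ‖x - A x‖ := hb x
    have h3 : x - A x = K.starProjection (x - L.starProjection x) := by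
      rw [hAapp, map_sub, K.starProjection_eq_self_iff.2 hxK]
    rw [h3, hx1] at h2
    have h4 := K.norm_starProjection_apply_le (x - L.starProjection x)
    rw [lt_div_iff₀ hC] at hx
    nlinarith
  have hle : ∀ t ∈ spectrum ℝ A, t ≤ 1 := by
    intro t ht
    have h1 := spectrum.norm_le_norm_mul_of_mem ht
    have h2 : ‖(1 : H →L[ℂ] H)‖ ≤ 1 := ContinuousLinearMap.norm_id_le
    exact (le_abs_self t).trans (h1.trans (mul_le_one₀ hnorm (norm_nonneg _) h2))
  -- If σ(A) misses (1 - δ, 1), then f vanishes on σ(A) except at 1, so A f(A) = f(A) ≠ 0. Its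
  -- values are fixed by A and hence lie in K ∩ L = 0.
  let f : ℝ → ℝ := fun t => max 0 (t - (1 - δ))
  have hf : Continuous f := by fun_prop
  have hfix : A * cfc f A = cfc f A := by
    have h1 : cfc (fun t => t * f t) A = A * cfc f A := by
      rw [cfc_mul (fun t => t) f A continuousOn_id hf.continuousOn, cfc_id' ℝ A]
    rw [← h1]
    refine cfc_congr fun t ht => ?_
    rcases le_or_gt t (1 - δ) with h2 | h2
    · have : f t = 0 := max_eq_left (by linarith)
      simp only [this, mul_zero]
    · have : t = 1 := le_antisymm (hle t ht) (hno t ht h2)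
      simp only [this, one_mul]
  have hne : cfc f A ≠ 0 := by
    intro h0
    have h1 : f 1 ∈ spectrum ℝ (cfc f A) := by
      rw [cfc_map_spectrum f A hsa hf.continuousOn]
      exact ⟨1, hone, rfl⟩
    have h2 : f 1 = δ := by
      simp only [f, sub_sub_cancel]
      exact max_eq_right hδ.le
    rw [h0, h2, spectrum.mem_iff, sub_zero] at h1
    exact h1 ((isUnit_iff_ne_zero.2 hδ.ne').map (algebraMap ℝ (H →L[ℂ] H)))
  obtain ⟨v, hv⟩ : ∃ v, cfc f A v ≠ 0 := by
    by_contra! h0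
    exact hne (ContinuousLinearMap.ext h0)
  have hw : A (cfc f A v) = cfc f A v := congrArg (fun S : H →L[ℂ] H => S v) hfix
  rw [hAapp] at hw
  have hwK : cfc f A v ∈ K := by
    rw [← hw]
    exact K.starProjection_apply_mem _
  rw [K.starProjection_eq_self_iff.2 hwK] at hw
  have hmem := mem_inf_of_starProjection_starProjection_eq L K hw
  rw [inf_comm, hKL] at hmem
  exact hv hmem

/-- Since A maps into `K`, the part of the error A x - l x orthogonal to `K` is l(P_K x - x). As l >
0, an approximate eigenvector is nearly in `K`, and P_K x can be normalised. -/
theorem exists_mem_norm_sub_smul_lt [CompleteSpace H] {l : ℝ} (hl0 : 0 < l)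
    (hl : l ∈ spectrum ℝ (K.starProjection * L.starProjection * K.starProjection))
    {ε : ℝ} (hε : 0 < ε) :
    ∃ x ∈ K, ‖x‖ = 1 ∧ ‖K.starProjection (L.starProjection x) - (l : ℂ) • x‖ < ε := by
  obtain ⟨η, hη, hη1, hη2⟩ : ∃ η : ℝ, 0 < η ∧ 2 * η ≤ ε ∧ 2 * η ≤ l :=
    ⟨min ε l / 2, by positivity, by linarith [min_le_left ε l], by linarith [min_le_right ε l]⟩
  obtain ⟨x, hx⟩ := exists_norm_apply_sub_smul_lt (isSelfAdjoint_starProjection_mul_mul K L) hl hη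
  set d : H := (K.starProjection * L.starProjection * K.starProjection) x - (l : ℂ) • x with hd
  set u := K.starProjection x with hu
  have hKu : K.starProjection u = u := K.starProjection_eq_self_iff.2 (K.starProjection_apply_mem x)
  have hAx : (K.starProjection * L.starProjection * K.starProjection) x =
      K.starProjection (L.starProjection u) := rfl
  have hKd : K.starProjection d = K.starProjection (L.starProjection u) - (l : ℂ) • u := by
    rw [hd, hAx, map_sub, map_smul, ← hu, K.starProjection_eq_self_iff.2
      (K.starProjection_apply_mem (L.starProjection u))]
  have hdK : d - K.starProjection d = (l : ℂ) • (u - x) := by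
    rw [hKd, hd, hAx, smul_sub]
    abel
  have h1 : l * ‖u - x‖ ≤ ‖d‖ := by
    have h2 := norm_sub_starProjection_sq K d
    have h3 : ‖d - K.starProjection d‖ ≤ ‖d‖ :=
      by
      rw [← sq_le_sq₀ (norm_nonneg _) (norm_nonneg _), h2]
      linarith [sq_nonneg ‖K.starProjection d‖]
    rwa [hdK, norm_smul, Complex.norm_real, Real.norm_of_nonneg hl0.le] at h3
  have hx2 : ‖x‖ < 2 * ‖u‖ := by
    have h2 : ‖x‖ ≤ ‖u‖ + ‖u - x‖ := norm_le_norm_add_norm_sub u x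
    have h3 : l * ‖u - x‖ < l * (‖x‖ / 2) := by nlinarith [norm_nonneg x]
    have h4 := lt_of_mul_lt_mul_left h3 hl0.le
    linarith
  have hu0 : 0 < ‖u‖ := by linarith [norm_nonneg x]
  refine ⟨((‖u‖⁻¹ : ℝ) : ℂ) • u, K.smul_mem _ (K.starProjection_apply_mem x), ?_, ?_⟩
  · rw [norm_smul, Complex.norm_real, norm_inv, norm_norm, inv_mul_cancel₀ hu0.ne']
  · rw [map_smul, map_smul, smul_comm, ← smul_sub, ← hKd, norm_smul, Complex.norm_real, norm_inv,
      norm_norm, ← div_eq_inv_mul, div_lt_iff₀ hu0]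
    have h2 := K.norm_starProjection_apply_le d
    nlinarith

theorem ellipse_subset_closure_numericalRange [CompleteSpace H] {l : ℝ} (hl0 : 0 < l) (hl1 : l < 1)
    (hl : l ∈ spectrum ℝ (K.starProjection * L.starProjection * K.starProjection)) :
    ellipse l ⊆ closure (numericalRange (L.starProjection * K.starProjection)) := by
  intro z hz
  obtain ⟨a, b, hab, rfl⟩ := exists_eq_of_mem_ellipse hl0 hl1 hz
  set m := Real.sqrt (l * (1 - l)) with hm
  have hm0 : 0 < m := Real.sqrt_pos.2 (mul_pos hl0 (by linarith))
  have hm2 : m ^ 2 = l * (1 - l) := Real.sq_sqrt (mul_nonneg hl0.le (by linarith))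
  have hm0' : (m : ℂ) ≠ 0 := by exact_mod_cast hm0.ne'
  have hm2' : (m : ℂ) ^ 2 = l * (1 - l) := by exact_mod_cast hm2
  choose x hxK hx1 hx using fun n : ℕ => exists_mem_norm_sub_smul_lt K L hl0 hl
    (ε := 1 / ((n : ℝ) + 1)) (by positivity)
  set g : ℕ → H := fun n => L.starProjection (x n) with hg
  set h : ℕ → H := fun n => K.starProjection (g n) - (l : ℂ) • x n with hh
  have hh0 : Tendsto h atTop (𝓝 0) := by
    rw [tendsto_zero_iff_norm_tendsto_zero]
    exact squeeze_zero (fun n => norm_nonneg _) (fun n => (hx n).le)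
      tendsto_one_div_add_atTop_nhds_zero_nat
  set G : ℕ → ℂ := fun n => inner ℂ (x n) (g n) with hG
  have hxx : ∀ n, inner ℂ (x n) (x n) = (1 : ℂ) := fun n => by
    rw [inner_self_eq_norm_sq_to_K, hx1]; simp
  have hgx : ∀ n, inner ℂ (g n) (x n) = G n := fun n => L.inner_starProjection_left_eq_right _ _
  have hgg : ∀ n, inner ℂ (g n) (g n) = G n := fun n => by
    rw [hG, hg]
    simp only
    rw [L.inner_starProjection_left_eq_right,
      L.starProjection_eq_self_iff.2 (L.starProjection_apply_mem _)]
  have hGlim : Tendsto G atTop (𝓝 (l : ℂ)) := by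
    have h1 : ∀ n, G n = l + inner ℂ (x n) (h n) := fun n => by
      have h2 : G n = inner ℂ (x n) (K.starProjection (g n)) := by
        rw [← K.inner_starProjection_left_eq_right, K.starProjection_eq_self_iff.2 (hxK n)]
      rw [h2, hh]
      simp only
      rw [inner_sub_right, inner_smul_right, hxx]
      ring
    have h3 : Tendsto (fun n => inner ℂ (x n) (h n)) atTop (𝓝 (0 : ℂ)) := by
      refine squeeze_zero_norm (fun n => ?_) (tendsto_zero_iff_norm_tendsto_zero.1 hh0)
      simpa [hx1 n] using norm_inner_le_norm (𝕜 := ℂ) (x n) (h n)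
    have h4 := h3.const_add (l : ℂ)
    rw [add_zero] at h4
    exact h4.congr fun n => (h1 n).symm
  -- In the limit x and e = (g - l x)/m are orthonormal with T x = l x + m e and T e = 0. The test
  -- vector y = p x + q g is a x + b̄ e, so ⟨T y, y⟩ tends to l a² + m a b.
  set q : ℂ := (starRingEnd ℂ) b / m with hq
  set p : ℂ := a - l * q with hp
  have hcq : (starRingEnd ℂ) q = b / m := by
    rw [hq, map_div₀, Complex.conj_conj, Complex.conj_ofReal]
  have hcp : (starRingEnd ℂ) p = a - l * (b / m) := by
    rw [hp, map_sub, map_mul, hcq, Complex.conj_ofReal, Complex.conj_ofReal]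
  have hbb : (starRingEnd ℂ) b * b = 1 - a ^ 2 := by
    rw [mul_comm, Complex.mul_conj, Complex.normSq_eq_norm_sq]
    exact_mod_cast eq_sub_of_add_eq' hab
  set y : ℕ → H := fun n => p • x n + q • g n with hy
  have hyn : ∀ n, ‖y n‖ ≤ ‖p‖ + ‖q‖ := fun n => by
    refine (norm_add_le _ _).trans ?_
    rw [norm_smul, norm_smul, hx1, mul_one]
    have h1 : ‖g n‖ ≤ 1 := hx1 n ▸ L.norm_starProjection_apply_le (x n)
    nlinarith [norm_nonneg q]
  refine mem_closure_numericalRange_of_tendsto _ (y := y) ?_ ?_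
  · have h1 : ∀ n, inner ℂ (y n) (y n) = (starRingEnd ℂ) p * p +
        ((starRingEnd ℂ) p * q + (starRingEnd ℂ) q * p + (starRingEnd ℂ) q * q) * G n := fun n => by
      simp only [hy, inner_add_left, inner_add_right, inner_smul_left, inner_smul_right, hxx, hgx,
        hgg]
      rw [show inner ℂ (x n) (g n) = G n from rfl]
      ring
    have h2 := (hGlim.const_mul ((starRingEnd ℂ) p * q + (starRingEnd ℂ) q * p +
      (starRingEnd ℂ) q * q)).const_add ((starRingEnd ℂ) p * p)
    have h3 : (starRingEnd ℂ) p * p + ((starRingEnd ℂ) p * q + (starRingEnd ℂ) q * p +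
        (starRingEnd ℂ) q * q) * l = 1 := by
      have h4 : (starRingEnd ℂ) q * q * (l * (1 - l)) = 1 - a ^ 2 := by
        rw [← hm2', hcq, ← hbb, hq]
        field_simp
      rw [hcp, ← hcq, hp]
      linear_combination h4
    rw [h3] at h2
    exact h2.congr fun n => (h1 n).symm
  · have h1 : ∀ n, (L.starProjection * K.starProjection) (y n) =
        (a : ℂ) • g n + q • L.starProjection (h n) := fun n => by
      have h2 : K.starProjection (g n) = (l : ℂ) • x n + h n := by
        rw [hh]; simp
      rw [mul_apply_eq_comp, hy]
      simp only
      rw [map_add, map_smul, map_smul, h2, K.starProjection_eq_self_iff.2 (hxK n), map_add,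
        map_smul, map_smul, map_add, map_smul, show L.starProjection (x n) = g n from rfl, hp]
      module
    have h3 : ∀ n, inner ℂ (y n) ((L.starProjection * K.starProjection) (y n)) =
        a * ((starRingEnd ℂ) p + (starRingEnd ℂ) q) * G n +
          inner ℂ (y n) (q • L.starProjection (h n)) := fun n => by
      rw [h1, inner_add_right]
      congr 1
      simp only [hy, inner_add_left, inner_smul_left, inner_smul_right, hgg]
      rw [show inner ℂ (x n) (g n) = G n from rfl]
      ring
    have h4 : Tendsto (fun n => inner ℂ (y n) (q • L.starProjection (h n))) atTop (𝓝 (0 : ℂ)) := by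
      have h5 : Tendsto (fun n => (‖p‖ + ‖q‖) * (‖q‖ * ‖h n‖)) atTop (𝓝 0) := by
        simpa using ((tendsto_zero_iff_norm_tendsto_zero.1 hh0).const_mul ‖q‖).const_mul
          (‖p‖ + ‖q‖)
      refine squeeze_zero_norm (fun n => ?_) h5
      refine (norm_inner_le_norm _ _).trans ?_
      rw [norm_smul]
      gcongr
      · exact hyn n
      · exact L.norm_starProjection_apply_le _
    have h6 := (hGlim.const_mul (a * ((starRingEnd ℂ) p + (starRingEnd ℂ) q))).add h4
    have h7 : a * ((starRingEnd ℂ) p + (starRingEnd ℂ) q) * l + 0 =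
        (l : ℂ) * a ^ 2 + m * a * b := by
      rw [hcp, hcq]
      field_simp
      linear_combination (-(a : ℂ) * b) * hm2'
    rw [h7] at h6
    exact h6.congr fun n => (h3 n).symm

theorem exists_forall_ellipse_subset_closure_numericalRange [CompleteSpace H] (hKL : K ⊓ L = ⊥)
    (h : ‖L.starProjection * K.starProjection‖ = 1) :
    ∃ l : ℕ → ℝ, (∀ n, l n ∈ Set.Ico (0 : ℝ) 1) ∧ Tendsto l atTop (𝓝 1) ∧
      ∀ n, ellipse (l n) ⊆ closure (numericalRange (L.starProjection * K.starProjection)) := by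
  choose l hl hl1 hl2 using fun n : ℕ => exists_mem_spectrum_lt_one K L hKL h
    (δ := 1 / ((n : ℝ) + 1)) (by positivity)
  have h0 : ∀ n, 0 < l n := fun n => by
    have h1 : 1 / ((n : ℝ) + 1) ≤ 1 := by
      rw [div_le_one (by positivity)]
      linarith [(Nat.cast_nonneg n : (0 : ℝ) ≤ n)]
    linarith [hl1 n]
  refine ⟨l, fun n => ⟨(h0 n).le, hl2 n⟩, ?_, fun n =>
    ellipse_subset_closure_numericalRange K L (h0 n) (hl2 n) (hl n)⟩
  have h1 : Tendsto (fun n : ℕ => (1 : ℝ) - 1 / ((n : ℝ) + 1)) atTop (𝓝 1) := by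
    simpa using (tendsto_one_div_add_atTop_nhds_zero_nat (𝕜 := ℝ)).const_sub 1
  exact tendsto_of_tendsto_of_tendsto_of_le_of_le h1 tendsto_const_nhds (fun n => (hl1 n).le)
    (fun n => (hl2 n).le)

end Ellipses

end TwoProjections

theorem mainTheorem7 {H : Type*} [NormedAddCommGroup H] [InnerProductSpace ℂ H] [CompleteSpace H]
    (N₁ N₂ : ClosedSubmodule ℂ H) (hN : N₁.toSubmodule ⊓ N₂.toSubmodule = ⊥) :
    List.TFAE [
      TwoProjections.ConvergesArbitrarilySlowly
        (fun n => TwoProjections.projProd N₂ N₁ ^ n) 0,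
      ‖TwoProjections.projProd N₂ N₁‖ = 1,
      ¬ IsClosed ((N₁.toSubmoduleᗮ ⊔ N₂.toSubmoduleᗮ : Submodule ℂ H) : Set H),
      (1 : ℂ) ∈ spectrum ℂ (TwoProjections.projProd N₂ N₁),
      TwoProjections.friedrichsCos N₁.toSubmodule N₂.toSubmodule = 1,
      (1 : ℂ) ∈ closure (TwoProjections.numericalRange (TwoProjections.projProd N₂ N₁)),
      ∃ lam : ℕ → ℝ, (∀ n, lam n ∈ Set.Ico (0 : ℝ) 1) ∧
        Filter.Tendsto lam Filter.atTop (nhds 1) ∧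
        ∀ n, TwoProjections.ellipse (lam n) ⊆
          closure (TwoProjections.numericalRange (TwoProjections.projProd N₂ N₁)),
      ¬ ∃ θ : ℝ, θ < Real.pi / 6 ∧
        TwoProjections.numericalRange (TwoProjections.projProd N₂ N₁) ⊆
          TwoProjections.sectorAtOne θ] := by
  have : N₁.toSubmodule.HasOrthogonalProjection := inferInstance
  have h_norm := TwoProjections.norm_starProjection_mul_lt_one_iff N₁.toSubmodule N₂.toSubmodule
  unfold TwoProjections.projProd
  tfae_have 1 ↔ 2 := TwoProjections.convergesArbitrarilySlowly_pow_iff _ _ hN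
  tfae_have 2 → 3 := TwoProjections.not_isClosed_orthogonal_sup_of_norm_eq_one _ _ hN
  tfae_have 3 → 2 := fun h => by
    by_contra hne
    exact h (TwoProjections.isClosed_orthogonal_sup_of_norm_lt_one _ _ (h_norm.2 hne))
  tfae_have 4 ↔ 2 := TwoProjections.one_mem_spectrum_iff _ _
  tfae_have 5 ↔ 2 := TwoProjections.friedrichsCos_eq_one_iff _ _ hN
  tfae_have 6 → 2 := fun h => le_antisymm
    (TwoProjections.norm_starProjection_mul_le_one _ _)
    (by simpa using TwoProjections.norm_le_of_mem_closure_numericalRange _ h)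
  tfae_have 2 → 7 := TwoProjections.exists_forall_ellipse_subset_closure_numericalRange _ _ hN
  tfae_have 7 → 6 := by
    rintro ⟨l, hl, hlim, hsub⟩
    have h1 : Tendsto (fun n => (l n : ℂ)) atTop (𝓝 ((1 : ℝ) : ℂ)) :=
      (Complex.continuous_ofReal.tendsto 1).comp hlim
    rw [Complex.ofReal_one] at h1
    exact isClosed_closure.mem_of_tendsto h1 (Eventually.of_forall fun n =>
      hsub n (TwoProjections.ofReal_mem_ellipse (hl n).1 (hl n).2.le))
  tfae_have 7 → 8 := by
    rintro ⟨l, hl, hlim, hsub⟩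
    exact TwoProjections.not_ellipse_subset_sectorAtOne hl hlim hsub
  tfae_have 8 → 2 := fun h => by
    by_contra hne
    exact h (TwoProjections.exists_numericalRange_subset_sectorAtOne _ _ (h_norm.2 hne))
  tfae_finish
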